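/- All graphs are finite and simple, and a coloring means an edge-coloring with colors in $\mathbb{N}$. Let $K_r^t$ denote the complete $r$-partite graph all of whose partite sets have size $t$. A coloring $c$ of a graph $G$ is extremal for $\mathrm{ar}(G,H)$ if it has no rainbow copy of $H$ (a copy of $H$ whose edges have pairwise distinct colors) and uses the maximum number of colors among all colorings of $G$ with no rainbow copy of $H$. A color is saturated by a vertex $v$ of a colored graph if it appears on an edge and every edge of that color is incident to $v$; let $S(v)$ be the set of colors saturated by $v$. Nonadjacent vertices $u,v$ are symmetric in the colored graph if $N(u)=N(v)$ and there is a bijection $\sigma:S(u)\to S(v)$ such that for every $x\in N(u)$, $c(vx)=c(ux)$ if $c(ux)\notin S(u)$, and $c(vx)=\sigma(c(ux))$ if $c(ux)\in S(u)$. A coloring of a complete multipartite graph is totally symmetric if any two vertices in a common partite set are symmetric. For a coloring $c_K$ of $K_r$ on $\{v_1,\dots,v_r\}$, its $t$-blow-up is the coloring of $K_r^t$ with partite sets $U_i=\{u_i^1,\dots,u_i^t\}$, unique up to renaming colors, defined as follows: for each color $a$ of $c_K$ and each edge $v_iv_j$ of color $a$, the edge $u_i^pu_j^q$ receives the color $a$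 if no vertex of $K_r$ saturates $a$; a color $a_p$ depending only on $a$ and $p$ if $v_i$ is the only vertex saturating $a$; and a color $a_{p,q}$ of its own if both $v_i$ and $v_j$ saturate $a$ (all these new colors being distinct). **Theorem.** Let $r>k\ge 4$ and $t\ge 2$, and let $c$ be a totally symmetric extremal coloring for $\mathrm{ar}(K_r^t,K_k)$. Then, up to renaming colors, $c$ is the $t$-blow-up of a coloring $c_K$ of $K_r$ for which there is a spanning subgraph $L$ of $K_r$ such that $L$ is rainbow in $c_K$, all edges of $K_r$ outside $L$ have one common color that does not occur on $L$, and one of the following holds: 1. $k=4$, $r=5$, and $L$ is isomorphic to the hourglass (two triangles sharing exactly one vertex) or to the house (a $4$-cycle and a triangle sharing exactly one edge); 2. $k=4$, $r=6$, and $L$ is isomorphic to the prism (two disjoint triangles joined by a perfect matching); 3. $L$ is isomorphic to the Turán graph $T_{r,k-2}$, the complete $(k-2)$-partite graph on $r$ vertices whose partite sets differ in size by at most one. -/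

import Mathlib

namespace AntiRamsey

open SimpleGraph

/-- The number `c(G)` of colours used by an edge-colouring `c` of `G`. -/
noncomputable def numColors {V α : Type*} {G : SimpleGraph V} (c : EdgeLabeling G α) : ℕ :=
  (Set.range c).ncard

/-- The colouring `c` of `G` contains no rainbow copy of `H`, that is, no copy of `H` whose edges
have pairwise different colours. -/
def RainbowFree {V W α : Type*} {G : SimpleGraph V} (H : SimpleGraph W)
    (c : EdgeLabeling G α) : Prop :=
  ∀ φ : Copy H G, ¬ Function.Injective (c.pullback φ.toHom)

/-- `c` is an extremal colouring for the anti-Ramsey number `ar(G, H)`: it has no rainbow copy of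
`H`, and it uses the maximum number of colours among all such colourings. -/
def IsExtremalColoring {V W : Type*} {G : SimpleGraph V} (H : SimpleGraph W)
    (c : EdgeLabeling G ℕ) : Prop :=
  RainbowFree H c ∧ ∀ c' : EdgeLabeling G ℕ, RainbowFree H c' → numColors c' ≤ numColors c

/-- The set of colours saturated by the vertex `v`: colours that appear at `v` and all of whose
edges are incident to `v`. -/
def saturated {V α : Type*} {G : SimpleGraph V} (c : EdgeLabeling G α) (v : V) : Set α :=
  {a | (∃ e : G.edgeSet, v ∈ (e : Sym2 V) ∧ c e = a) ∧
    ∀ e : G.edgeSet, c e = a → v ∈ (e : Sym2 V)}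

/-- The nonadjacent vertices `u` and `v` are symmetric in the coloured graph: they have the same
neighbours, and there is a bijection `σ` from the colours saturated by `u` to the colours saturated
by `v` such that, for every common neighbour `x`, `c(vx) = c(ux)` if `c(ux)` is not saturated by
`u`, and `c(vx) = σ(c(ux))` if it is. -/
def SymmetricVertices {V α : Type*} {G : SimpleGraph V} (c : EdgeLabeling G α) (u v : V) : Prop :=
  ¬ G.Adj u v ∧ G.neighborSet u = G.neighborSet v ∧
    ∃ σ : saturated c u ≃ saturated c v, ∀ (x : V) (hu : G.Adj u x) (hv : G.Adj v x),
      (c.get u x hu ∉ saturated c u → c.get v x hv = c.get u x hu) ∧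
      (∀ h : c.get u x hu ∈ saturated c u, c.get v x hv = σ ⟨c.get u x hu, h⟩)

/-- A colouring of a complete multipartite graph is totally symmetric if any two vertices in a
common partite set are symmetric. -/
def TotallySymmetric {ι α : Type*} {U : ι → Type*}
    (c : EdgeLabeling (completeMultipartiteGraph U) α) : Prop :=
  ∀ (i : ι) (x y : U i), SymmetricVertices c ⟨i, x⟩ ⟨i, y⟩

/-- The blow-up of `G` with size function `f`. -/
abbrev blowUp {V : Type*} (G : SimpleGraph V) (f : V → ℕ) : SimpleGraph (Σ v : V, Fin (f v)) :=
  G.comap Sigma.fst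

/-- The projection of a blow-up to the original graph. -/
def blowUpProj {V : Type*} (G : SimpleGraph V) (f : V → ℕ) : blowUp G f →g G :=
  ⟨Sigma.fst, fun h => h⟩

/-- The blow-up of a coloured graph. An edge `e` lying over an edge `e'` of `G` with `c(e') = a`
receives the colour `a` indexed by the set of those endpoints `x` of `e` for which `a` is saturated
by the vertex of `G` below `x`. Thus for `e = xy` the new colour is

* `(a, ∅)`, the same for all edges over edges of colour `a`, if no vertex of `G` saturates `a`;
* `(a, {x})`, one colour for each vertex `x` over `v`, if `v` is the only vertex saturating `a`;
* `(a, {x, y})`, an exclusive colour for each edge over `e'`, if two vertices saturate `a`. -/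
def blowUpColoring {V α : Type*} {G : SimpleGraph V} (c : EdgeLabeling G α) (f : V → ℕ) :
    EdgeLabeling (blowUp G f) (α × Set (Σ v : V, Fin (f v))) :=
  fun e => (c ((blowUpProj G f).mapEdgeSet e),
    {x | x ∈ (e : Sym2 _) ∧ c ((blowUpProj G f).mapEdgeSet e) ∈ saturated c x.1})

/-- The graph isomorphism `ρ` is an isomorphism of coloured graphs: together with some bijection
between the sets of used colours it respects the colourings. -/
def IsColoredIso {V W α β : Type*} {G : SimpleGraph V} {G' : SimpleGraph W}
    (c : EdgeLabeling G α) (c' : EdgeLabeling G' β) (ρ : G ≃g G') : Prop :=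
  ∃ σ : Set.range c ≃ Set.range c', ∀ e : G.edgeSet,
    (σ ⟨c e, Set.mem_range_self e⟩ : β) = c' (ρ.mapEdgeSet e)

/-- In the colouring `c` of the complete graph on `V`, the subgraph `L` is rainbow and all other
edges have one extra common colour, not used on `L`. -/
def IsRainbowPlusOne {V α : Type*} (c : TopEdgeLabeling V α) (L : SimpleGraph V) : Prop :=
  (∀ e₁ e₂ : (⊤ : SimpleGraph V).edgeSet, (e₁ : Sym2 V) ∈ L.edgeSet → (e₂ : Sym2 V) ∈ L.edgeSet →
    c e₁ = c e₂ → e₁ = e₂) ∧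
  ∃ a : α, ∀ e : (⊤ : SimpleGraph V).edgeSet, (e : Sym2 V) ∉ L.edgeSet ↔ c e = a

/-- Two triangles sharing exactly one vertex. -/
def hourglass : SimpleGraph (Fin 5) :=
  fromEdgeSet {s(0, 1), s(0, 2), s(1, 2), s(2, 3), s(2, 4), s(3, 4)}

/-- A 4-cycle and a triangle sharing exactly one edge. -/
def house : SimpleGraph (Fin 5) :=
  fromEdgeSet {s(0, 1), s(1, 2), s(2, 3), s(3, 0), s(2, 4), s(3, 4)}

/-- Two disjoint triangles joined by a perfect matching. -/
def prism : SimpleGraph (Fin 6) :=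
  fromEdgeSet {s(0, 1), s(0, 2), s(1, 2), s(3, 4), s(3, 5), s(4, 5), s(0, 3), s(1, 4), s(2, 5)}

end AntiRamsey

/-!
Let `cK` be the colouring that `c` induces on a transversal of the partite sets. Total symmetry
makes the colour classes of the blow-up of `cK` refine those of `c`; as that blow-up has no rainbow
`K_k` either, extremality of `c` forces the colour classes to agree.

Put `p = k - 2` and let `T` be the number of edges of the Turán graph `T_{r,p}`. Suppose that `u`
colours of `cK` occur exactly once and `m` colours occur more often. The theorem of
Montellano-Ballesteros and Neumann-Lara bounds the colours of `cK`, so `u + m ≤ T + 1`, and `u ≤ T`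
because a rainbow colouring of the graph `L` of the edges whose colour occurs once, with one common
colour for all other edges of `K_r`, has no rainbow `K_k` either. A colour occurring once becomes at
most `t²` colours of the blow-up, and a repeated colour at most `t`, whereas a rainbow blow-up of
`T_{r,p}` and one further colour are more than `t² T` colours. Hence `t² T < t² u + t m`, and
`t ≥ 2` leaves only `u = T` and `m = 1`.

It remains to find the graphs `L` with `T` edges such that no `L + uv` contains a `K_{p+2}`. If `L`
has no `K_{p+1}`, it is the Turán graph. Otherwise let `X` be a clique on `p + 1` vertices. Every
other vertex has at most `p - 1` neighbours in `X`, and counting edges inside `X`, outside `X` and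
in between leaves only `p = 2` with two or three vertices outside `X`: the hourglass, the house and
the prism.
-/

namespace AntiRamsey

open SimpleGraph Finset

section Colorings

variable {V W V' α : Type*} {G : SimpleGraph V} {G' : SimpleGraph V'} {H : SimpleGraph W}
  {C : EdgeLabeling G α}

lemma mem_of_mem_saturated {v : V} {e : G.edgeSet} (h : C e ∈ saturated C v) :
    v ∈ (e : Sym2 V) :=
  h.2 e rfl

lemma eq_or_eq_of_get_mem_saturated {v x y : V} {hxy : G.Adj x y}
    (h : C.get x y hxy ∈ saturated C v) : v = x ∨ v = y :=
  Sym2.mem_iff.1 (mem_of_mem_saturated h)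

lemma mem_saturated_iff {v : V} {e : G.edgeSet} (he : v ∈ (e : Sym2 V)) :
    C e ∈ saturated C v ↔ ∀ e', C e' = C e → v ∈ (e' : Sym2 V) :=
  ⟨fun h => h.2, fun h => ⟨⟨e, he, rfl⟩, h⟩⟩

lemma eq_of_mem_saturated {u v : V} (huv : u ≠ v) {e e' : G.edgeSet}
    (hu : C e ∈ saturated C u) (hv : C e ∈ saturated C v) (h : C e' = C e) : e' = e :=
  Subtype.ext (((Sym2.mem_and_mem_iff huv).1 ⟨hu.2 e' h, hv.2 e' h⟩).trans
    ((Sym2.mem_and_mem_iff huv).1 ⟨hu.2 e rfl, hv.2 e rfl⟩).symm)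

lemma mem_saturated_pullback {φ : G' →g G} (hφ : Function.Injective φ) {e : G'.edgeSet} {v : V'}
    (h : C (φ.mapEdgeSet e) ∈ saturated C (φ v)) :
    C.pullback φ e ∈ saturated (C.pullback φ) v := by
  have mem_of_map_mem (e' : G'.edgeSet) (h' : φ v ∈ (φ.mapEdgeSet e' : Sym2 V)) :
      v ∈ (e' : Sym2 V') := by
    obtain ⟨w, hw, hwv⟩ := Sym2.mem_map.1 h'
    exact hφ hwv ▸ hw
  exact (mem_saturated_iff (mem_of_map_mem e (mem_of_mem_saturated h))).2
    fun e' he' => mem_of_map_mem e' (h.2 _ he')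

lemma RainbowFree.pullback (hC : RainbowFree H C) (φ : G' →g G) (hφ : Function.Injective φ) :
    RainbowFree H (C.pullback φ) := by
  intro ψ hψ
  have mapEdgeSet_comp (e) : (φ.comp ψ.toHom).mapEdgeSet e =
      φ.mapEdgeSet (ψ.toHom.mapEdgeSet e) :=
    Subtype.ext (by simp [Hom.mapEdgeSet, Sym2.map_map])
  refine hC ⟨φ.comp ψ.toHom, hφ.comp ψ.injective⟩ fun e e' h => hψ ?_
  simpa only [EdgeLabeling.pullback_apply, mapEdgeSet_comp] using h

/-- The edges of `G` inside `X` have pairwise different colours. -/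
def RainbowOn (C : EdgeLabeling G α) (X : Finset V) : Prop :=
  Set.InjOn C {e | ∀ x ∈ (e : Sym2 V), x ∈ X}

lemma rainbowOn_map_copy {k : ℕ} (φ : Copy (completeGraph (Fin k)) G)
    (hφ : Function.Injective (C.pullback φ.toHom)) : RainbowOn C (univ.map φ.toEmbedding) := by
  have lift (e : G.edgeSet) (he : ∀ x ∈ (e : Sym2 V), x ∈ univ.map φ.toEmbedding) :
      ∃ e₀, φ.toHom.mapEdgeSet e₀ = e := by
    obtain ⟨⟨x, y⟩, hxy⟩ := e
    obtain ⟨i, -, rfl⟩ := mem_map.1 (he x (Sym2.mem_mk_left x y))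
    obtain ⟨j, -, rfl⟩ := mem_map.1 (he y (Sym2.mem_mk_right _ y))
    exact ⟨⟨s(i, j), fun hij => hxy.ne (congrArg _ hij)⟩, rfl⟩
  intro e he e' he' h
  obtain ⟨e₀, rfl⟩ := lift e he
  obtain ⟨e₀', rfl⟩ := lift e' he'
  exact congrArg _ (hφ h)

lemma rainbowFree_completeGraph_iff {k : ℕ} :
    RainbowFree (completeGraph (Fin k)) C ↔ ∀ X, G.IsNClique k X → ¬ RainbowOn C X := by
  refine ⟨fun hC X hX hrainbow => ?_, fun hC φ hφ => hC _ ?_ (rainbowOn_map_copy φ hφ)⟩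
  · let ι := X.equivFinOfCardEq hX.card_eq
    let φ : Copy (completeGraph (Fin k)) G :=
      ⟨⟨fun i => ι.symm i, fun {i j} hij => hX.isClique (ι.symm i).2 (ι.symm j).2
        fun h => hij (ι.symm.injective (Subtype.ext h))⟩,
        Subtype.val_injective.comp ι.symm.injective⟩
    have map_subset (e) : ∀ x ∈ (φ.toHom.mapEdgeSet e : Sym2 V), x ∈ X := by
      intro x hx
      obtain ⟨i, -, rfl⟩ := Sym2.mem_map.1 hx
      exact (ι.symm i).2
    exact hC φ fun e e' h => Hom.mapEdgeSet.injective φ.toHom φ.injective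
      (hrainbow (map_subset e) (map_subset e') h)
  · simpa using isNClique_map_copy_top φ

lemma numColors_le_card_edgeFinset [Fintype G.edgeSet] : numColors C ≤ #G.edgeFinset := by
  rw [edgeFinset_card, ← Nat.card_eq_fintype_card]
  exact Finite.card_range_le C

end Colorings

section Turan

variable {n p : ℕ}

lemma card_edgeFinset_turanGraph_of_le (h : n ≤ p) :
    #(turanGraph n p).edgeFinset = n.choose 2 := by
  have := card_edgeFinset_top_eq_card_choose_two (V := Fin n)
  rw [Fintype.card_fin] at this
  convert! this
  exact turanGraph_eq_top.2 (Or.inr h)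

lemma card_edgeFinset_turanGraph_succ (hp : 0 < p) (n : ℕ) :
    #(turanGraph (n + 1) p).edgeFinset = #(turanGraph n p).edgeFinset + (n - n / p) := by
  induction n using Nat.strong_induction_on with
  | _ n ih =>
    rcases lt_or_ge n p with hnp | hpn
    · rw [card_edgeFinset_turanGraph_of_le hnp, card_edgeFinset_turanGraph_of_le hnp.le,
        Nat.div_eq_of_lt hnp, Nat.choose_succ_succ' n 1, Nat.choose_one_right, Nat.sub_zero,
        add_comm]
    · obtain ⟨m, rfl⟩ := Nat.exists_eq_add_of_le' hpn
      have hm := ih m (by omega)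
      have hmp : m / p ≤ m := Nat.div_le_self m p
      rw [add_right_comm, card_edgeFinset_turanGraph_add, card_edgeFinset_turanGraph_add, hm,
        Nat.add_div_right m hp, add_one_mul]
      omega

lemma card_edgeFinset_turanGraph_self_succ (hp : 0 < p) :
    #(turanGraph (p + 1) p).edgeFinset + 1 = (p + 1).choose 2 := by
  rw [card_edgeFinset_turanGraph_succ hp, card_edgeFinset_turanGraph_of_le le_rfl,
    Nat.div_self hp, Nat.choose_succ_succ' p 1, Nat.choose_one_right, add_assoc,
    Nat.sub_add_cancel hp, add_comm]

end Turan

lemma pairwiseDisjoint_of_sum_card_le {ι β : Type*} [DecidableEq β] {T : Finset ι}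
    {f : ι → Finset β} (h : ∑ i ∈ T, #(f i) ≤ #(T.biUnion f)) :
    (T : Set ι).PairwiseDisjoint f := by
  classical
  intro i hi j hj hij
  have hsplit : T.biUnion f = f i ∪ (T.erase i).biUnion f := by
    rw [← biUnion_insert, insert_erase hi]
  have hunion := card_union_add_card_inter (f i) ((T.erase i).biUnion f)
  have hrest := card_biUnion_le (s := T.erase i) (t := f)
  have hsum := add_sum_erase T (fun i => #(f i)) hi
  rw [hsplit] at h
  have hinter : #(f i ∩ (T.erase i).biUnion f) = 0 := by omega
  exact (disjoint_iff_inter_eq_empty.2 (card_eq_zero.1 hinter)).mono_right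
    (subset_biUnion_of_mem f (mem_erase.2 ⟨hij.symm, hj⟩))

section AntiRamseyNumber

variable {V α : Type*} {C : TopEdgeLabeling V α} {E : Set (⊤ : SimpleGraph V).edgeSet}

lemma numColors_le_numColors_pullback_add [Finite V] (C : TopEdgeLabeling V α) (v : V) :
    numColors C ≤ numColors (C.pullback (.subtype (· ≠ v))) + (saturated C v).ncard := by
  have saturated_subset : saturated C v ⊆ Set.range C := fun a ⟨⟨e, _, he⟩, _⟩ => ⟨e, he⟩
  refine (Set.ncard_le_ncard ?_ ?_).trans (Set.ncard_union_le _ _)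
  · rintro _ ⟨e, rfl⟩
    by_cases h : ∀ e', C e' = C e → v ∈ (e' : Sym2 V)
    · exact Or.inr ⟨⟨e, h e rfl, rfl⟩, h⟩
    · push Not at h
      obtain ⟨⟨⟨x, y⟩, hxy⟩, hC, hv⟩ := h
      obtain ⟨hx, hy⟩ := not_or.1 (Sym2.mem_iff.not.1 hv)
      exact Or.inl ⟨⟨s(⟨x, Ne.symm hx⟩, ⟨y, Ne.symm hy⟩), fun h => hxy (congrArg Subtype.val h)⟩,
        hC⟩
  · exact (Set.finite_range _).union ((Set.finite_range C).subset saturated_subset)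

/-- In a set `E` of representative edges, one for every colour, the edge `xy` is directed from `x`
to `y` if its colour is saturated by `x`; it may be directed both ways. -/
def IsArc (C : TopEdgeLabeling V α) (E : Set (⊤ : SimpleGraph V).edgeSet) (x y : V) : Prop :=
  ∃ h : x ≠ y, ⟨s(x, y), h⟩ ∈ E ∧ C.get x y h ∈ saturated C x

/-- The underlying undirected graph of `IsArc`. -/
def arcGraph (C : TopEdgeLabeling V α) (E : Set (⊤ : SimpleGraph V).edgeSet) : SimpleGraph V :=
  fromRel (IsArc C E)

lemma arcGraph_adj {x y : V} : (arcGraph C E).Adj x y ↔ IsArc C E x y ∨ IsArc C E y x :=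
  (fromRel_adj _ x y).trans
    ⟨And.right, fun h => ⟨h.elim (fun h => h.1) fun h => h.1.symm, h⟩⟩

lemma IsArc.ne {x y : V} (h : IsArc C E x y) : x ≠ y := h.1

lemma get_notMem_saturated {u v x : V} (huv : u ≠ v) (hu : x ≠ u) (hv : x ≠ v) :
    C.get u v huv ∉ saturated C x :=
  fun h => (eq_or_eq_of_get_mem_saturated h).elim hu hv

open Classical in
/-- The vertices that are not out-neighbours of `x` in the digraph `IsArc`, such as `x` itself. -/
noncomputable def missed [Fintype V] (C : TopEdgeLabeling V α)
    (E : Set (⊤ : SimpleGraph V).edgeSet) (x : V) : Finset V :=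
  {y | ¬ IsArc C E x y}

lemma notMem_missed [Fintype V] {x y : V} : y ∉ missed C E x ↔ IsArc C E x y := by
  simp [missed]

lemma rainbowOn_of_isArc (hE : E.InjOn C) {X : Finset V} {u v : V} (huv : u ≠ v)
    (h : ∀ x ∈ X, ∀ y ∈ X, x ≠ y → s(x, y) ≠ s(u, v) →
      (IsArc C E x y ∧ C.get u v huv ∉ saturated C x) ∨
      (IsArc C E y x ∧ C.get u v huv ∉ saturated C y)) : RainbowOn C X := by
  have mem_and_ne (e : (⊤ : SimpleGraph V).edgeSet) (he : ∀ x ∈ (e : Sym2 V), x ∈ X)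
      (hne : e ≠ ⟨s(u, v), huv⟩) : e ∈ E ∧ C e ≠ C.get u v huv := by
    obtain ⟨⟨x, y⟩, hxy⟩ := e
    rcases h x (he x (Sym2.mem_mk_left x y)) y (he y (Sym2.mem_mk_right x y)) hxy
      (fun h => hne (Subtype.ext h)) with ⟨⟨hxy, hE, hs⟩, huvs⟩ | ⟨⟨hyx, hE, hs⟩, huvs⟩
    · exact ⟨hE, fun heq => huvs (by rw [← heq]; exact hs)⟩
    · rw [C.get_comm] at hs
      simp only [Sym2.eq_swap (a := y)] at hE
      exact ⟨hE, fun heq => huvs (by rw [← heq]; exact hs)⟩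
  intro e he e' he' hee
  by_cases h₁ : e = ⟨s(u, v), huv⟩ <;> by_cases h₂ : e' = ⟨s(u, v), huv⟩
  · rw [h₁, h₂]
  · exact absurd (hee.symm.trans (congrArg C h₁)) (mem_and_ne e' he' h₂).2
  · exact absurd (hee.trans (congrArg C h₂)) (mem_and_ne e he h₁).2
  · exact hE (mem_and_ne e he h₁).1 (mem_and_ne e' he' h₂).1 hee

lemma exists_get_notMem_saturated {X : Finset V} (hX : ¬ RainbowOn C X) :
    ∃ v w, ∃ h : v ≠ w, C.get v w h ∉ saturated C v := by
  by_contra! hall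
  refine hX fun e _ e' _ h => ?_
  obtain ⟨⟨x, y⟩, hxy⟩ := e'
  have hyx := hall y x (Ne.symm hxy)
  rw [C.get_comm] at hyx
  exact eq_of_mem_saturated hxy (hall x y hxy) hyx h

lemma rainbowOn_insert_insert [DecidableEq V] (hE : E.InjOn C) {T : Finset V}
    (hT : (arcGraph C E).IsClique T) {u z : V} (huz : u ≠ z) (hu : ∀ x ∈ T, IsArc C E x u)
    (hz : ∀ x ∈ T, IsArc C E x z) : RainbowOn C (insert u (insert z T)) := by
  have hsat : ∀ x ∈ T, C.get u z huz ∉ saturated C x := fun x hx =>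
    get_notMem_saturated huz (hu x hx).ne (hz x hx).ne
  refine rainbowOn_of_isArc hE huz fun x hx y hy hxy hne => ?_
  simp only [mem_insert] at hx hy
  rcases hx with rfl | rfl | hx <;> rcases hy with rfl | rfl | hy
  · exact absurd rfl hxy
  · exact absurd rfl hne
  · exact Or.inr ⟨hu y hy, hsat y hy⟩
  · exact absurd Sym2.eq_swap hne
  · exact absurd rfl hxy
  · exact Or.inr ⟨hz y hy, hsat y hy⟩
  · exact Or.inl ⟨hu x hx, hsat x hx⟩
  · exact Or.inl ⟨hz x hx, hsat x hx⟩
  · exact (arcGraph_adj.1 (hT hx hy hxy)).imp (fun h => ⟨h, hsat x hx⟩) fun h => ⟨h, hsat y hy⟩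

lemma rainbowOn_insert [DecidableEq V] (hE : E.InjOn C) {T : Finset V}
    (hT : (arcGraph C E).IsClique T) {v w : V} (hvw : v ≠ w) (hsat : C.get v w hvw ∉ saturated C v)
    (hw : ∀ x ∈ T, x ≠ v → IsArc C E x w) : RainbowOn C (insert w T) := by
  have hsat' : ∀ x ∈ T, C.get v w hvw ∉ saturated C x := fun x hx => by
    by_cases hxv : x = v
    · rwa [hxv]
    · exact get_notMem_saturated hvw hxv (hw x hx hxv).ne
  refine rainbowOn_of_isArc hE hvw fun x hx y hy hxy hne => ?_
  rw [mem_insert] at hx hy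
  rcases hx with rfl | hx <;> rcases hy with rfl | hy
  · exact absurd rfl hxy
  · exact Or.inr ⟨hw y hy fun h => hne (h ▸ Sym2.eq_swap), hsat' y hy⟩
  · exact Or.inl ⟨hw x hx fun h => hne (h ▸ rfl), hsat' x hx⟩
  · exact (arcGraph_adj.1 (hT hx hy hxy)).imp (fun h => ⟨h, hsat' x hx⟩) fun h => ⟨h, hsat' y hy⟩

lemma isNClique_insert_of_isArc [DecidableEq V] {T : Finset V} {n : ℕ}
    (hT : (arcGraph C E).IsNClique n T) {z : V} (hz : ∀ x ∈ T, IsArc C E x z) :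
    (arcGraph C E).IsNClique (n + 1) (insert z T) :=
  hT.insert fun x hx => arcGraph_adj.2 (Or.inr (hz x hx))

variable [Fintype V]

lemma ncard_saturated_add_card_missed_le (hE : E.SurjOn C (Set.range C)) (v : V) :
    (saturated C v).ncard + #(missed C E v) ≤ Fintype.card V := by
  classical
  have key : ∀ a ∈ saturated C v, ∃ y, ∃ h : v ≠ y, ⟨s(v, y), h⟩ ∈ E ∧ C.get v y h = a := by
    rintro a ⟨⟨e₀, -, rfl⟩, hsat⟩
    obtain ⟨⟨e, he⟩, heE, hea⟩ := hE (Set.mem_range_self e₀)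
    obtain ⟨y, rfl⟩ := hsat _ hea
    exact ⟨y, he, heE, hea⟩
  have : Nonempty V := ⟨v⟩
  choose! g hg hgE hga using key
  have hle : (saturated C v).ncard ≤ #(missed C E v)ᶜ := by
    rw [← Set.ncard_coe_finset]
    refine Set.ncard_le_ncard_of_injOn g (fun a ha => ?_) fun a ha b hb hab => ?_
    · exact mem_coe.2 (mem_compl.2 (notMem_missed.2 ⟨hg a ha, hgE a ha, (hga a ha).symm ▸ ha⟩))
    · rw [← hga a ha, ← hga b hb]
      simp only [hab]
  have := card_add_card_compl (missed C E v)
  omega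

variable {p d : ℕ}

lemma exists_forall_isArc {T : Finset V} (hd : ∀ x, #(missed C E x) ≤ d)
    (hT : #T * d < Fintype.card V) : ∃ z, ∀ x ∈ T, IsArc C E x z := by
  classical
  have hlt : #(T.biUnion (missed C E)) < #(univ : Finset V) :=
    (card_biUnion_le_card_mul _ _ d fun x _ => hd x).trans_lt hT
  obtain ⟨z, -, hz⟩ := exists_mem_notMem_of_card_lt_card hlt
  exact ⟨z, fun x hx => notMem_missed.1 fun h => hz (mem_biUnion.2 ⟨x, hx, h⟩)⟩

lemma exists_isNClique_arcGraph (hd : ∀ x, #(missed C E x) ≤ d) (v : V) {m : ℕ}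
    (hm : m * d < Fintype.card V) : ∃ T, v ∈ T ∧ (arcGraph C E).IsNClique (m + 1) T := by
  classical
  induction m with
  | zero => exact ⟨{v}, mem_singleton_self v, by simp⟩
  | succ m ih =>
    obtain ⟨T, hvT, hT⟩ := ih (lt_of_le_of_lt (Nat.mul_le_mul_right d m.le_succ) hm)
    obtain ⟨z, hz⟩ := exists_forall_isArc (T := T) hd (by rwa [hT.card_eq])
    exact ⟨insert z T, mem_insert_of_mem hvT, isNClique_insert_of_isArc hT hz⟩

lemma pairwiseDisjoint_missed (hE : E.InjOn C) (hd : ∀ x, #(missed C E x) ≤ d)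
    (hpd : p * d < Fintype.card V) (hfree : ∀ X, #X = p + 2 → ¬ RainbowOn C X) {T : Finset V}
    (hT : (arcGraph C E).IsNClique p T) : (T : Set V).PairwiseDisjoint (missed C E) := by
  classical
  obtain ⟨z, hz⟩ := exists_forall_isArc (T := T) hd (by rwa [hT.card_eq])
  have cover : univ.erase z ⊆ T.biUnion (missed C E) := by
    intro u hu
    by_contra hmissed
    have hu' : ∀ x ∈ T, IsArc C E x u := fun x hx =>
      notMem_missed.1 fun h => hmissed (mem_biUnion.2 ⟨x, hx, h⟩)
    have huT : u ∉ insert z T := fun h =>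
      (mem_insert.1 h).elim (ne_of_mem_erase hu) fun h => (hu' u h).ne rfl
    refine hfree _ ?_ (rainbowOn_insert_insert hE hT.isClique (ne_of_mem_erase hu) hu' hz)
    rw [card_insert_of_notMem huT, (isNClique_insert_of_isArc hT hz).card_eq]
  refine pairwiseDisjoint_of_sum_card_le ?_
  calc ∑ x ∈ T, #(missed C E x) ≤ p * d := by
        simpa [hT.card_eq] using sum_le_card_nsmul T _ d fun x _ => hd x
    _ ≤ #(univ.erase z) := by rw [card_erase_of_mem (mem_univ z), card_univ]; omega
    _ ≤ _ := card_le_card cover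

-- As every vertex misses at most `d` vertices, cliques of `arcGraph` can be grown greedily. If `v`
-- does not saturate the colour of `vw`, then `w` is missed by `v`, hence by no other vertex of the
-- cliques through `v`, and it extends such a clique with `vw` as the only edge that is not an arc.
lemma exists_rainbowOn (hp : 2 ≤ p) (hV : p + 2 ≤ Fintype.card V) (hE : E.InjOn C)
    (hd : ∀ x, #(missed C E x) ≤ d) (hpd : p * d < Fintype.card V) :
    ∃ X, #X = p + 2 ∧ RainbowOn C X := by
  classical
  by_contra! hfree
  obtain ⟨X, -, hX⟩ := exists_subset_card_eq hV
  obtain ⟨v, w, hvw, hsat⟩ := exists_get_notMem_saturated (hfree X hX)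
  obtain ⟨q, rfl⟩ := Nat.exists_eq_add_of_le' hp
  have hle {m : ℕ} (hm : m ≤ q + 2) : m * d < Fintype.card V :=
    (Nat.mul_le_mul_right d hm).trans_lt hpd
  obtain ⟨T, hvT, hT⟩ := exists_isNClique_arcGraph (m := q) hd v (hle (by omega))
  obtain ⟨y, hy⟩ := exists_forall_isArc (T := T) hd (hT.card_eq ▸ hle (by omega))
  have hTy := isNClique_insert_of_isArc hT hy
  obtain ⟨z, hz⟩ := exists_forall_isArc (T := insert y T) hd (hTy.card_eq ▸ hle le_rfl)
  have hTz := isNClique_insert_of_isArc hT fun x hx => hz x (mem_insert_of_mem hx)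
  have hwv : w ∈ missed C E v := by
    by_contra h
    exact hsat (notMem_missed.1 h).2.2
  have isArc_of_mem {T' : Finset V} (hT' : (arcGraph C E).IsNClique (q + 2) T') (hv : v ∈ T')
      {x : V} (hx : x ∈ T') (hxv : x ≠ v) : IsArc C E x w :=
    notMem_missed.1 (disjoint_left.1
      (pairwiseDisjoint_missed hE hd hpd hfree hT' hv hx hxv.symm) hwv)
  have hw : ∀ x ∈ insert z (insert y T), x ≠ v → IsArc C E x w := by
    intro x hx hxv
    rcases mem_insert.1 hx with rfl | hx
    · exact isArc_of_mem hTz (mem_insert_of_mem hvT) (mem_insert_self x T) hxv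
    · exact isArc_of_mem hTy (mem_insert_of_mem hvT) hx hxv
  have hTyz := isNClique_insert_of_isArc hTy hz
  have hwT : w ∉ insert z (insert y T) := fun h => (hw w h hvw.symm).ne rfl
  exact hfree _ (by rw [card_insert_of_notMem hwT, hTyz.card_eq])
    (rainbowOn_insert hE hTyz.isClique hvw hsat hw)

end AntiRamseyNumber

/-- Montellano-Ballesteros and Neumann-Lara. In a counterexample with the fewest vertices every
vertex saturates many colours, so that `missed` is small everywhere. -/
theorem numColors_le_of_rainbowFree {V α : Type*} [Fintype V] {p : ℕ} (hp : 2 ≤ p)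
    {C : TopEdgeLabeling V α} (hC : RainbowFree (completeGraph (Fin (p + 2))) C) :
    numColors C ≤ #(turanGraph (Fintype.card V) p).edgeFinset + 1 := by
  classical
  induction hn : Fintype.card V generalizing V with
  | zero =>
    have := numColors_le_card_edgeFinset (C := C)
    rw [card_edgeFinset_top_eq_card_choose_two, hn, Nat.choose_zero_succ] at this
    omega
  | succ n ih =>
    rcases le_or_gt n p with hnp | hpn
    · have hle := numColors_le_card_edgeFinset (C := C)
      rw [card_edgeFinset_top_eq_card_choose_two, hn] at hle
      rcases hnp.lt_or_eq with hnp | rfl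
      · rw [card_edgeFinset_turanGraph_of_le (n := n + 1) hnp]
        omega
      · rwa [card_edgeFinset_turanGraph_self_succ (by omega)]
    by_contra! hlt
    rw [card_edgeFinset_turanGraph_succ (by omega)] at hlt
    have card_erase (v : V) : Fintype.card {x // x ≠ v} = n := by
      rw [Fintype.card_subtype_compl, Fintype.card_subtype_eq, hn, Nat.add_sub_cancel]
    obtain ⟨E, -, hE⟩ := Set.SurjOn.exists_bijOn_subset (f := C) (s := Set.univ)
      (t := Set.range C) fun _ ⟨e, he⟩ => ⟨e, trivial, he⟩
    have hmissed (v : V) : #(missed C E v) ≤ n / p := by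
      have h₁ : numColors (C.pullback (.subtype (· ≠ v))) ≤ _ :=
        ih (RainbowFree.pullback hC _ Subtype.val_injective) (card_erase v)
      have h₂ := numColors_le_numColors_pullback_add C v
      have h₃ := ncard_saturated_add_card_missed_le hE.surjOn v
      have h₄ := Nat.div_le_self n p
      omega
    obtain ⟨X, hX, hrainbow⟩ := exists_rainbowOn hp (by omega) hE.injOn hmissed
      (by have := Nat.mul_div_le n p; omega)
    exact rainbowFree_completeGraph_iff.1 hC X ⟨fun _ _ _ _ h => h, hX⟩ hrainbow

section Extremal

variable {V W β : Type*} {G L : SimpleGraph V} {H : SimpleGraph W}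

lemma IsExtremalColoring.numColors_le [Finite V] {c : EdgeLabeling G ℕ}
    (hc : IsExtremalColoring H c) {c' : EdgeLabeling G β} (hc' : RainbowFree H c') :
    numColors c' ≤ numColors c := by
  obtain ⟨f, hf⟩ := Set.countable_iff_exists_injOn.1 (Set.finite_range c').countable
  have hfree : RainbowFree H (c'.compRight f) := fun φ hφ => hc' φ fun e e' h =>
    hφ (congrArg f h)
  calc numColors c' = (f '' Set.range c').ncard := hf.ncard_image.symm
    _ = numColors (c'.compRight f) := congrArg Set.ncard (Set.range_comp f c').symm
    _ ≤ numColors c := hc.2 _ hfree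

open Classical in
/-- The edge labeling of `G` in which the edges of `L` have colours of their own and all remaining
edges share the colour `none`. -/
noncomputable def rainbowPlusOne (G L : SimpleGraph V) : EdgeLabeling G (Option (Sym2 V)) :=
  fun e => if (e : Sym2 V) ∈ L.edgeSet then some e else none

/-- `G` contains no `K_n`, and adding any single edge to `G` does not create one. -/
def RobustlyCliqueFree (G : SimpleGraph V) (n : ℕ) : Prop :=
  ∀ u v, (G ⊔ edge u v).CliqueFree n

lemma RobustlyCliqueFree.not_isNClique {n : ℕ} (hn : 0 < n) (hL : RobustlyCliqueFree L n)
    (X : Finset V) : ¬ L.IsNClique n X := by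
  intro hX
  obtain ⟨u, -⟩ := card_pos.1 (hX.card_eq ▸ hn)
  have := hL u u
  rw [sup_edge_self] at this
  exact this X hX

lemma RobustlyCliqueFree.ne_top [Fintype V] {n : ℕ} (hn : 0 < n) (hV : n ≤ Fintype.card V)
    (hL : RobustlyCliqueFree L n) : L ≠ ⊤ := by
  rintro rfl
  obtain ⟨X, -, hX⟩ := exists_subset_card_eq (s := (univ : Finset V)) hV
  exact hL.not_isNClique hn X ⟨fun _ _ _ _ h => h, hX⟩

lemma rainbowFree_rainbowPlusOne {k : ℕ} (hk : 0 < k) (hL : RobustlyCliqueFree L k) :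
    RainbowFree (completeGraph (Fin k)) (rainbowPlusOne G L) := by
  refine rainbowFree_completeGraph_iff.2 fun X hX hrainbow => ?_
  by_cases hclique : L.IsClique X
  · exact hL.not_isNClique hk X ⟨hclique, hX.card_eq⟩
  simp only [IsClique, Set.Pairwise] at hclique
  push Not at hclique
  obtain ⟨u, hu, v, hv, huv, hLuv⟩ := hclique
  refine hL u v X ⟨fun x hx y hy hxy => ?_, hX.card_eq⟩
  by_contra hadj
  obtain ⟨hLxy, hne⟩ := not_or.1 hadj
  have heq := @hrainbow ⟨s(u, v), hX.isClique hu hv huv⟩ (by simpa using ⟨hu, hv⟩)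
    ⟨s(x, y), hX.isClique hx hy hxy⟩ (by simpa using ⟨hx, hy⟩)
    (by simp [rainbowPlusOne, hLuv, hLxy])
  exact hne ((adj_edge u v).2 ⟨congrArg Subtype.val heq, hxy⟩)

lemma card_edgeFinset_lt_numColors_rainbowPlusOne [Finite V] [Fintype L.edgeSet] (hL : L < G) :
    #L.edgeFinset < numColors (rainbowPlusOne G L) := by
  obtain ⟨e₀, he₀G, he₀L⟩ := Set.exists_of_ssubset (edgeSet_ssubset_edgeSet.2 hL)
  have subset_range : insert none (some '' L.edgeSet) ⊆ Set.range (rainbowPlusOne G L) := by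
    rintro _ (rfl | ⟨e, he, rfl⟩)
    · exact ⟨⟨e₀, he₀G⟩, if_neg he₀L⟩
    · exact ⟨⟨e, edgeSet_subset_edgeSet.2 hL.le he⟩, if_pos he⟩
  calc #L.edgeFinset < (insert none (some '' L.edgeSet)).ncard := by
        rw [Set.ncard_insert_of_notMem (by simp) (Set.toFinite _),
          Set.ncard_image_of_injective _ (Option.some_injective _), Set.ncard_eq_toFinset_card']
        exact Nat.lt_succ_self _
    _ ≤ numColors (rainbowPlusOne G L) := Set.ncard_le_ncard subset_range (Set.finite_range _)

lemma RobustlyCliqueFree.card_edgeFinset_le [Fintype V] [Fintype L.edgeSet] {p : ℕ} (hp : 2 ≤ p)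
    (hL : RobustlyCliqueFree L (p + 2)) (hne : L ≠ ⊤) :
    #L.edgeFinset ≤ #(turanGraph (Fintype.card V) p).edgeFinset := by
  have hlt := card_edgeFinset_lt_numColors_rainbowPlusOne hne.lt_top
  have hle := numColors_le_of_rainbowFree hp
    (rainbowFree_rainbowPlusOne (G := ⊤) (Nat.succ_pos _) hL)
  omega

lemma IsExtremalColoring.card_edgeFinset_lt [Finite V] [Fintype L.edgeSet] {k : ℕ} (hk : 0 < k)
    {c : EdgeLabeling G ℕ} (hc : IsExtremalColoring (completeGraph (Fin k)) c) (hL : L < G)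
    (hfree : RobustlyCliqueFree L k) : #L.edgeFinset < numColors c :=
  (card_edgeFinset_lt_numColors_rainbowPlusOne hL).trans_le
    (hc.numColors_le (rainbowFree_rainbowPlusOne hk hfree))

lemma cliqueFree_blowUp {n : ℕ} (hG : G.CliqueFree n) (f : V → ℕ) :
    (blowUp G f).CliqueFree n := by
  classical
  intro X hX
  have injOn_fst : Set.InjOn Sigma.fst (X : Set (Σ v, Fin (f v))) := fun x hx y hy hxy => by
    by_contra hne
    have hadj : G.Adj x.1 y.1 := hX.isClique hx hy hne
    exact hadj.ne hxy
  refine hG (X.image Sigma.fst) ⟨?_, (card_image_of_injOn injOn_fst).trans hX.card_eq⟩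
  rw [coe_image]
  rintro _ ⟨x, hx, rfl⟩ _ ⟨y, hy, rfl⟩ hxy
  exact hX.isClique hx hy fun h => hxy (congrArg _ h)

lemma card_edgeFinset_blowUp [Fintype V] [DecidableRel G.Adj] (t : ℕ) :
    #(blowUp G fun _ => t).edgeFinset = t ^ 2 * #G.edgeFinset := by
  classical
  have degree_blowUp (x : Σ _ : V, Fin t) : (blowUp G fun _ => t).degree x = t * G.degree x.1 := by
    rw [degree, degree, mul_comm]
    trans #((G.neighborFinset x.1).sigma fun _ => (univ : Finset (Fin t)))
    · congr 1
      ext y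
      simp
    · simp [card_sigma]
  have sum_degree_blowUp : ∑ x, (blowUp G fun _ => t).degree x = t * (t * ∑ v, G.degree v) := by
    simp only [degree_blowUp]
    refine (Fintype.sum_sigma' fun v (_ : Fin t) => t * G.degree v).trans ?_
    simp only [sum_const, card_univ, Fintype.card_fin, smul_eq_mul, mul_sum]
  rw [sum_degrees_eq_twice_card_edges, sum_degrees_eq_twice_card_edges] at sum_degree_blowUp
  linarith

lemma sq_mul_card_edgeFinset_turanGraph_lt_numColors {r p t : ℕ} (hp : 0 < p) (hpr : p < r)
    (ht : 0 < t) {c : EdgeLabeling (completeMultipartiteGraph fun _ : Fin r => Fin t) ℕ}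
    (hc : IsExtremalColoring (completeGraph (Fin (p + 2))) c) :
    t ^ 2 * #(turanGraph r p).edgeFinset < numColors c := by
  have hlt : blowUp (turanGraph r p) (fun _ => t) < completeMultipartiteGraph fun _ => Fin t := by
    refine lt_of_le_not_ge (fun x y h => ?_) fun hle => ?_
    · have hxy : (turanGraph r p).Adj x.1 y.1 := h
      exact hxy.ne
    have hne : turanGraph r p ≠ ⊤ := turanGraph_eq_top.not.2 (by omega)
    exact hne (top_le_iff.1 fun v w hvw => @hle ⟨v, ⟨0, ht⟩⟩ ⟨w, ⟨0, ht⟩⟩ hvw)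
  rw [← card_edgeFinset_blowUp]
  exact hc.card_edgeFinset_lt (Nat.succ_pos _) hlt
    fun u v => (cliqueFree_blowUp (turanGraph_cliqueFree hp) _).sup_edge u v

end Extremal

section Structure

variable {V W : Type*} {L : SimpleGraph V} {n p : ℕ}

lemma RobustlyCliqueFree.comap {f : W → V} (hf : Function.Injective f)
    (hL : RobustlyCliqueFree L n) : RobustlyCliqueFree (L.comap f) n := fun u v =>
  ((hL (f u) (f v)).comap (Embedding.comap ⟨f, hf⟩ _).isContained).anti <| by
    intro x y h
    simpa [edge_adj, hf.eq_iff, hf.ne_iff] using h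

lemma RobustlyCliqueFree.card_filter_adj_add_two_le [DecidableRel L.Adj]
    (hL : RobustlyCliqueFree L (n + 1)) {X : Finset V} (hX : L.IsNClique n X) {y : V} (hy : y ∉ X) :
    #{x ∈ X | L.Adj y x} + 2 ≤ n := by
  classical
  by_contra! hlt
  have hsplit := card_filter_add_card_filter_not (s := X) (L.Adj y ·)
  have hone : #{x ∈ X | ¬ L.Adj y x} ≤ 1 := by have := hX.card_eq; omega
  have : Nonempty V := ⟨y⟩
  obtain ⟨x₀, hx₀⟩ := card_le_one_iff_subset_singleton.1 hone
  have hadj : ∀ x ∈ X, (L ⊔ edge y x₀).Adj y x := fun x hx => by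
    by_cases h : L.Adj y x
    · exact Or.inl h
    · have hxx₀ := mem_singleton.1 (hx₀ (mem_filter.2 ⟨hx, h⟩))
      exact Or.inr ((adj_edge y x₀).2 ⟨hxx₀ ▸ rfl, fun hyx => hy (hyx ▸ hx)⟩)
  exact hL y x₀ _ ((hX.mono le_sup_left).insert hadj)

lemma eq_of_card_edgeFinset_turanGraph_eq_add {q a b c : ℕ} (hp : 2 ≤ p) (hq : 2 ≤ q)
    (ha : a ≤ (p + 1).choose 2) (hb : b ≤ q * (p - 1))
    (hc : c ≤ #(turanGraph q p).edgeFinset + if q = p + 1 then 1 else 0)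
    (h : #(turanGraph (q + 1 + p) p).edgeFinset = a + b + c) :
    p = 2 ∧ (q = 2 ∨ q = 3) ∧ b = q ∧ c = q.choose 2 := by
  have hchoose : (p + 1).choose 2 = p + p.choose 2 := by
    rw [Nat.choose_succ_succ' p 1, Nat.choose_one_right]
  rw [card_edgeFinset_turanGraph_add, card_edgeFinset_turanGraph_succ (by omega), add_one_mul] at h
  have hfew : q - q / p ≤ 1 + if q = p + 1 then 1 else 0 := by omega
  have hhalf : q / p ≤ q / 2 := Nat.div_le_div_left hp (by omega)
  have hp2 : p = 2 := by
    split_ifs at hfew with hqp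
    · rw [hqp, Nat.add_div_left _ (by omega), Nat.div_eq_of_lt (by omega)] at hfew
      omega
    · by_contra hne
      rw [Nat.div_eq_of_lt (by omega : q < p)] at hfew
      omega
  subst hp2
  have hq23 : q = 2 ∨ q = 3 := by split_ifs at hfew <;> omega
  have turan_two : #(turanGraph 2 2).edgeFinset = 1 := card_edgeFinset_turanGraph_of_le le_rfl
  have turan_three : #(turanGraph 3 2).edgeFinset + 1 = 3 :=
    card_edgeFinset_turanGraph_self_succ two_pos
  rcases hq23 with rfl | rfl <;>
    simp [Nat.choose] at ha hb hc h ⊢ <;> omega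

lemma eq_top_of_card_edgeFinset_eq [Fintype V] [Fintype L.edgeSet]
    (h : #L.edgeFinset = (Fintype.card V).choose 2) : L = ⊤ := by
  classical
  rw [← card_edgeFinset_top_eq_card_choose_two] at h
  exact edgeFinset_inj.1 (eq_of_subset_of_card_le (edgeFinset_mono le_top) h.ge)

lemma RobustlyCliqueFree.card_edgeFinset_le_add_ite [Fintype V] [DecidableRel L.Adj] (hp : 2 ≤ p)
    (hL : RobustlyCliqueFree L (p + 2)) : #L.edgeFinset ≤
      #(turanGraph (Fintype.card V) p).edgeFinset + if Fintype.card V = p + 1 then 1 else 0 := by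
  by_cases htop : L = ⊤
  · have hV : Fintype.card V < p + 2 := by
      by_contra! hV
      exact hL.ne_top (Nat.succ_pos _) hV htop
    have hle := card_edgeFinset_le_card_choose_two (G := L)
    split_ifs with h
    · rwa [h, card_edgeFinset_turanGraph_self_succ (by omega), ← h]
    · rwa [card_edgeFinset_turanGraph_of_le (by omega)]
  · exact (hL.card_edgeFinset_le hp htop).trans (Nat.le_add_right _ _)

lemma sum_card_filter_adj_self (L : SimpleGraph V) [DecidableRel L.Adj] (S : Finset V) :
    ∑ x ∈ S, #{y ∈ S | L.Adj x y} = 2 * #(L.induce (S : Set V)).edgeFinset := by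
  rw [← sum_degrees_eq_twice_card_edges, ← sum_coe_sort]
  refine sum_congr rfl fun x _ => ?_
  rw [degree, ← card_map (.subtype _)]
  congr 1
  ext y
  simp [and_comm]

variable [Fintype V] [DecidableEq V]

lemma card_edgeFinset_eq_add_sum_add (L : SimpleGraph V) [DecidableRel L.Adj] (X : Finset V) :
    #L.edgeFinset = #(L.induce (X : Set V)).edgeFinset + ∑ y ∈ Xᶜ, #{x ∈ X | L.Adj y x} +
      #(L.induce (Xᶜ : Finset V)).edgeFinset := by
  have cross_comm : ∑ x ∈ X, #{y ∈ Xᶜ | L.Adj x y} = ∑ y ∈ Xᶜ, #{x ∈ X | L.Adj y x} := by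
    simp only [card_filter]
    rw [sum_comm]
    simp only [L.adj_comm]
  have degree_eq (x : V) : L.degree x = #{y ∈ X | L.Adj x y} + #{y ∈ Xᶜ | L.Adj x y} := by
    simp only [← card_neighborFinset_eq_degree, neighborFinset_eq_filter, card_filter]
    exact (sum_add_sum_compl X _).symm
  have hdeg := sum_degrees_eq_twice_card_edges L
  rw [← sum_add_sum_compl X] at hdeg
  simp only [degree_eq, sum_add_distrib, sum_card_filter_adj_self, cross_comm] at hdeg
  omega

lemma RobustlyCliqueFree.isClique_compl_of_isNClique [DecidableRel L.Adj] (hp : 2 ≤ p)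
    (hn : p + 3 ≤ Fintype.card V) (hL : RobustlyCliqueFree L (p + 2))
    (hE : #L.edgeFinset = #(turanGraph (Fintype.card V) p).edgeFinset) {X : Finset V}
    (hX : L.IsNClique (p + 1) X) :
    p = 2 ∧ (#Xᶜ = 2 ∨ #Xᶜ = 3) ∧ L.IsClique (Xᶜ : Finset V) ∧
      ∀ y ∉ X, ∃! x, x ∈ X ∧ L.Adj y x := by
  have hcard : #Xᶜ = Fintype.card V - (p + 1) := hX.card_eq ▸ card_compl X
  have card_filter_le : ∀ y ∈ Xᶜ, #{x ∈ X | L.Adj y x} ≤ p - 1 := fun y hy => by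
    have := hL.card_filter_adj_add_two_le hX (mem_compl.1 hy)
    omega
  have hYX := sum_le_card_nsmul _ _ _ card_filter_le
  have hXX := card_edgeFinset_le_card_choose_two (G := L.induce (X : Set V))
  have hYY := (hL.comap Subtype.val_injective : RobustlyCliqueFree
    (L.induce (Xᶜ : Finset V)) (p + 2)).card_edgeFinset_le_add_ite hp
  have hXcard : Fintype.card (X : Set V) = p + 1 := by simp [hX.card_eq]
  have hYcard : Fintype.card ((Xᶜ : Finset V) : Set V) = #Xᶜ := by
    simp only [coe_sort_coe, Fintype.card_coe]
  rw [hXcard] at hXX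
  rw [hYcard] at hYY
  rw [card_edgeFinset_eq_add_sum_add L X,
    show Fintype.card V = #Xᶜ + 1 + p by omega] at hE
  obtain ⟨rfl, hq, hsum, hclique⟩ :=
    eq_of_card_edgeFinset_turanGraph_eq_add hp (by omega) hXX hYX hYY hE.symm
  refine ⟨rfl, hq, induce_eq_top.1 (eq_top_of_card_edgeFinset_eq (hclique.trans (by rw [hYcard]))),
    fun y hy => ?_⟩
  have card_filter_eq := (sum_eq_sum_iff_of_le card_filter_le).1
    (by rw [hsum, sum_const, smul_eq_mul, Nat.add_one_sub_one, mul_one]) y (mem_compl.2 hy)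
  obtain ⟨x, hx⟩ := card_eq_one.1 card_filter_eq
  have filter_iff (z : V) : z ∈ X ∧ L.Adj y z ↔ z = x := by
    rw [← mem_filter, hx, mem_singleton]
  exact ⟨x, (filter_iff x).2 rfl, fun z hz => (filter_iff z).1 hz⟩

end Structure

section ExtremalGraphs

variable {V : Type*} [Fintype V] {L : SimpleGraph V} {X : Finset V}

lemma nonempty_iso_of_injective {m : ℕ} (hV : Fintype.card V = m) {H : SimpleGraph (Fin m)}
    {g : Fin m → V} (hg : Function.Injective g)
    (h : ∀ i j, i < j → (L.Adj (g i) (g j) ↔ H.Adj i j)) : Nonempty (L ≃g H) := by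
  have hbij : Function.Bijective g :=
    (Fintype.bijective_iff_injective_and_card g).2 ⟨hg, by rw [hV, Fintype.card_fin]⟩
  refine ⟨(RelIso.symm ⟨Equiv.ofBijective g hbij, fun {i j} => ?_⟩ : L ≃g H)⟩
  rcases lt_trichotomy i j with hij | rfl | hij
  · exact h i j hij
  · exact iff_of_false (L.irrefl) H.irrefl
  · exact (L.adj_comm _ _).trans ((h j i hij).trans (H.adj_comm _ _))

lemma nonempty_iso_hourglass (hV : Fintype.card V = 5) (hX : L.IsNClique 3 X) {x y₁ y₂ : V}
    (hx : x ∈ X) (hy₁ : y₁ ∉ X) (hy₂ : y₂ ∉ X) (hyy : L.Adj y₁ y₂)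
    (h₁ : ∀ z ∈ X, L.Adj y₁ z ↔ z = x) (h₂ : ∀ z ∈ X, L.Adj y₂ z ↔ z = x) :
    Nonempty (L ≃g hourglass) := by
  classical
  obtain ⟨b, c, hbc, hbce⟩ := card_eq_two.1
    (show #(X.erase x) = 2 by rw [card_erase_of_mem hx, hX.card_eq])
  obtain ⟨hbx, hb⟩ := mem_erase.1 (hbce ▸ mem_insert_self b {c})
  obtain ⟨hcx, hc⟩ := mem_erase.1 (hbce ▸ mem_insert_of_mem (mem_singleton_self c))
  have hy := hyy.ne
  have adj_bc := hX.isClique hb hc hbc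
  have adj_xb := hX.isClique hx hb hbx.symm
  have adj_xc := hX.isClique hx hc hcx.symm
  refine nonempty_iso_of_injective hV (g := ![y₁, y₂, x, b, c]) ?_ ?_
  · intro i j
    fin_cases i <;> fin_cases j <;> simp <;> grind
  · intro i j
    fin_cases i <;> fin_cases j <;> simp [hourglass, *]

lemma nonempty_iso_house (hV : Fintype.card V = 5) (hX : L.IsNClique 3 X) {x₁ x₂ y₁ y₂ : V}
    (hx₁ : x₁ ∈ X) (hx₂ : x₂ ∈ X) (hxx : x₁ ≠ x₂) (hy₁ : y₁ ∉ X) (hy₂ : y₂ ∉ X)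
    (hyy : L.Adj y₁ y₂) (h₁ : ∀ z ∈ X, L.Adj y₁ z ↔ z = x₁)
    (h₂ : ∀ z ∈ X, L.Adj y₂ z ↔ z = x₂) : Nonempty (L ≃g house) := by
  classical
  obtain ⟨b, hbe⟩ := card_eq_one.1 (show #((X.erase x₁).erase x₂) = 1 by
    rw [card_erase_of_mem (mem_erase.2 ⟨hxx.symm, hx₂⟩), card_erase_of_mem hx₁, hX.card_eq])
  obtain ⟨hbx₂, hb⟩ := mem_erase.1 (hbe ▸ mem_singleton_self b)
  obtain ⟨hbx₁, hb⟩ := mem_erase.1 hb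
  have hy := hyy.ne
  have adj_x₁b := hX.isClique hx₁ hb hbx₁.symm
  have adj_x₂b := hX.isClique hx₂ hb hbx₂.symm
  have adj_xx := hX.isClique hx₁ hx₂ hxx
  refine nonempty_iso_of_injective hV (g := ![y₂, y₁, x₁, x₂, b]) ?_ ?_
  · intro i j
    fin_cases i <;> fin_cases j <;> simp <;> grind
  · intro i j
    fin_cases i <;> fin_cases j <;> simp [house, hxx.symm, hyy.symm, *]

lemma nonempty_iso_hourglass_or_house [DecidableEq V] (hV : Fintype.card V = 5)
    (hX : L.IsNClique 3 X) (hY : L.IsClique (Xᶜ : Finset V))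
    (hYX : ∀ y ∉ X, ∃! x, x ∈ X ∧ L.Adj y x) :
    Nonempty (L ≃g hourglass) ∨ Nonempty (L ≃g house) := by
  obtain ⟨y₁, y₂, hy, hye⟩ := card_eq_two.1
    (show #Xᶜ = 2 by rw [card_compl, hV, hX.card_eq])
  have hy₁ : y₁ ∈ Xᶜ := hye ▸ mem_insert_self y₁ {y₂}
  have hy₂ : y₂ ∈ Xᶜ := hye ▸ mem_insert_of_mem (mem_singleton_self y₂)
  have hyy := hY hy₁ hy₂ hy
  rw [mem_compl] at hy₁ hy₂
  obtain ⟨x₁, ⟨hx₁, hadj₁⟩, huniq₁⟩ := hYX y₁ hy₁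
  obtain ⟨x₂, ⟨hx₂, hadj₂⟩, huniq₂⟩ := hYX y₂ hy₂
  have h₁ : ∀ z ∈ X, L.Adj y₁ z ↔ z = x₁ := fun z hz =>
    ⟨fun h => huniq₁ z ⟨hz, h⟩, fun h => h ▸ hadj₁⟩
  have h₂ : ∀ z ∈ X, L.Adj y₂ z ↔ z = x₂ := fun z hz =>
    ⟨fun h => huniq₂ z ⟨hz, h⟩, fun h => h ▸ hadj₂⟩
  rcases eq_or_ne x₁ x₂ with rfl | hxx
  · exact Or.inl (nonempty_iso_hourglass hV hX hx₁ hy₁ hy₂ hyy h₁ h₂)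
  · exact Or.inr (nonempty_iso_house hV hX hx₁ hx₂ hxx hy₁ hy₂ hyy h₁ h₂)

lemma nonempty_iso_prism [DecidableEq V] (hV : Fintype.card V = 6) (hX : L.IsNClique 3 X)
    (hY : L.IsClique (Xᶜ : Finset V)) (hYX : ∀ y ∉ X, ∃! x, x ∈ X ∧ L.Adj y x)
    (hXY : ∀ x ∈ X, ∃! y, y ∉ X ∧ L.Adj x y) : Nonempty (L ≃g prism) := by
  choose! f hf using fun x hx => (hXY x hx).exists
  have adj_iff : ∀ x ∈ X, ∀ x' ∈ X, L.Adj x (f x') ↔ x = x' := fun x hx x' hx' =>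
    ⟨fun h => (hYX _ (hf x' hx').1).unique ⟨hx, h.symm⟩ ⟨hx', (hf x' hx').2.symm⟩,
      fun h => h ▸ (hf x hx).2⟩
  have map_ne_map : ∀ x ∈ X, ∀ x' ∈ X, x ≠ x' → f x ≠ f x' := fun x hx x' hx' hne h =>
    hne ((adj_iff x hx x' hx').1 (h ▸ (hf x hx).2))
  have adj_map : ∀ x ∈ X, ∀ x' ∈ X, x ≠ x' → L.Adj (f x) (f x') := fun x hx x' hx' hne =>
    hY (by simpa using (hf x hx).1) (by simpa using (hf x' hx').1) (map_ne_map x hx x' hx' hne)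
  have ne_map : ∀ x ∈ X, ∀ x' ∈ X, x ≠ f x' := fun x hx x' hx' h => (hf x' hx').1 (h ▸ hx)
  obtain ⟨x₁, x₂, x₃, hx₁₂, hx₁₃, hx₂₃, rfl⟩ := card_eq_three.1 hX.card_eq
  obtain ⟨adj₁₂, adj₁₃, adj₂₃⟩ := is3Clique_triple_iff.1 hX
  simp only [mem_insert, mem_singleton, forall_eq_or_imp, forall_eq]
    at adj_iff adj_map map_ne_map ne_map
  refine nonempty_iso_of_injective hV (g := ![x₁, x₂, x₃, f x₁, f x₂, f x₃]) ?_ ?_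
  · intro i j
    fin_cases i <;> fin_cases j <;> simp <;> grind only
  · intro i j
    fin_cases i <;> fin_cases j <;>
      simp [prism, adj₁₂, adj₁₃, adj₂₃, adj_iff, adj_map, hx₁₂, hx₁₃, hx₂₃,
        hx₁₂.symm, hx₁₃.symm, hx₂₃.symm]

theorem RobustlyCliqueFree.nonempty_iso_of_card_eq {p : ℕ} [DecidableRel L.Adj] (hp : 2 ≤ p)
    (hn : p + 3 ≤ Fintype.card V) (hL : RobustlyCliqueFree L (p + 2))
    (hE : #L.edgeFinset = #(turanGraph (Fintype.card V) p).edgeFinset) :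
    (p = 2 ∧ Fintype.card V = 5 ∧ (Nonempty (L ≃g hourglass) ∨ Nonempty (L ≃g house))) ∨
    (p = 2 ∧ Fintype.card V = 6 ∧ Nonempty (L ≃g prism)) ∨
    Nonempty (L ≃g turanGraph (Fintype.card V) p) := by
  classical
  by_cases hfree : L.CliqueFree (p + 1)
  · refine Or.inr (Or.inr ((isTuranMaximal_iff_nonempty_iso_turanGraph (by omega)).1
      ⟨hfree, fun H _ hH => ?_⟩))
    rw [hE, card_edgeFinset_turanGraph]
    exact hH.card_edgeFinset_le
  obtain ⟨X, hX⟩ : ∃ X, L.IsNClique (p + 1) X := by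
    simpa only [CliqueFree, not_forall, not_not] using hfree
  have hcard : #Xᶜ = Fintype.card V - (p + 1) := hX.card_eq ▸ card_compl X
  obtain ⟨rfl, hq, hY, hYX⟩ := hL.isClique_compl_of_isNClique hp hn hE hX
  rcases hq with hq | hq
  · exact Or.inl ⟨rfl, by omega, nonempty_iso_hourglass_or_house (by omega) hX hY hYX⟩
  · obtain ⟨-, -, -, hXY⟩ := hL.isClique_compl_of_isNClique hp hn hE ⟨hY, hq⟩
    refine Or.inr (Or.inl ⟨rfl, by omega, nonempty_iso_prism (by omega) hX hY hYX ?_⟩)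
    simpa only [compl_compl, mem_compl, not_not] using hXY

end ExtremalGraphs

section BlowUp

variable {V W α : Type*} {G : SimpleGraph V}

lemma rainbowFree_blowUpColoring {C : EdgeLabeling G α} (hC : RainbowFree (completeGraph W) C)
    (f : V → ℕ) : RainbowFree (completeGraph W) (blowUpColoring C f) := by
  intro φ hφ
  let ψ := (blowUpProj G f).comp φ.toHom
  have ψ_injective : Function.Injective ψ := Hom.injective_of_top_hom ψ
  have fst_eq {e e' : (completeGraph W).edgeSet} (h : C.pullback ψ e = C.pullback ψ e') :
      (blowUpColoring C f (φ.toHom.mapEdgeSet e)).1 =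
        (blowUpColoring C f (φ.toHom.mapEdgeSet e')).1 := by
    obtain ⟨⟨_, _⟩, _⟩ := e
    obtain ⟨⟨_, _⟩, _⟩ := e'
    exact h
  have snd_subset {e e' : (completeGraph W).edgeSet} (h : C.pullback ψ e = C.pullback ψ e') :
      (blowUpColoring C f (φ.toHom.mapEdgeSet e)).2 ⊆
        (blowUpColoring C f (φ.toHom.mapEdgeSet e')).2 := by
    rintro x ⟨hx, hsat⟩
    replace hsat : (blowUpColoring C f (φ.toHom.mapEdgeSet e)).1 ∈ saturated C x.1 := hsat
    rw [fst_eq h] at hsat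
    obtain ⟨i, -, rfl⟩ := Sym2.mem_map.1 hx
    obtain ⟨y, hy, hyi⟩ := Sym2.mem_map.1 (mem_of_mem_saturated hsat)
    obtain ⟨j, -, rfl⟩ := Sym2.mem_map.1 hy
    obtain rfl := ψ_injective hyi
    exact ⟨hy, hsat⟩
  exact hC ⟨ψ, ψ_injective⟩ fun e e' h => hφ
    (Prod.ext (fst_eq h) ((snd_subset h).antisymm (snd_subset h.symm)))

lemma SymmetricVertices.exists_translation {c : EdgeLabeling G α} {u v : V}
    (h : SymmetricVertices c u v) : ∃ τ : α → α,
      ∀ x (hu : G.Adj u x) (hv : G.Adj v x), c.get v x hv = τ (c.get u x hu) := by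
  classical
  obtain ⟨-, -, σ, hσ⟩ := h
  refine ⟨fun a => if ha : a ∈ saturated c u then σ ⟨a, ha⟩ else a,
    fun x hu hv => ?_⟩
  by_cases hs : c.get u x hu ∈ saturated c u
  · simp only [dif_pos hs, (hσ x hu hv).2 hs]
  · simp only [dif_neg hs, (hσ x hu hv).1 hs]

variable {f : V → ℕ}

/-- The copy of `G` in its blow-up that is spanned by the transversal `z`. -/
def blowUpSection (G : SimpleGraph V) (z : ∀ v, Fin (f v)) : G →g blowUp G f :=
  ⟨fun v => ⟨v, z v⟩, fun h => h⟩

variable {c : EdgeLabeling (blowUp G f) α} {z : ∀ v, Fin (f v)}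

lemma get_mem_saturated_pullback_blowUpSection {v w : V} {hvw : G.Adj v w}
    (h : c.get ⟨v, z v⟩ ⟨w, z w⟩ hvw ∈ saturated c ⟨v, z v⟩) :
    (c.pullback (blowUpSection G z)).get v w hvw ∈
      saturated (c.pullback (blowUpSection G z)) v :=
  mem_saturated_pullback (fun _ _ h => congrArg Sigma.fst h) h

lemma get_eq_get_of_notMem_saturated (hc : ∀ v p q, SymmetricVertices c ⟨v, p⟩ ⟨v, q⟩)
    {v : V} {y : Σ v, Fin (f v)} (hvy : G.Adj v y.1)
    (h : (c.pullback (blowUpSection G z)).get y.1 v hvy.symm ∉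
      saturated (c.pullback (blowUpSection G z)) y.1) :
    c.get ⟨v, z v⟩ y hvy = (c.pullback (blowUpSection G z)).get v y.1 hvy := by
  obtain ⟨-, -, _, hσ⟩ := hc y.1 (z y.1) y.2
  have hyv : G.Adj y.1 v := hvy.symm
  calc c.get ⟨v, z v⟩ y hvy = c.get y ⟨v, z v⟩ hyv := EdgeLabeling.get_comm ..
    _ = c.get ⟨y.1, z y.1⟩ ⟨v, z v⟩ hyv :=
      (hσ ⟨v, z v⟩ hyv hyv).1 (mt get_mem_saturated_pullback_blowUpSection h)
    _ = (c.pullback (blowUpSection G z)).get v y.1 hvy := EdgeLabeling.get_comm ..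

lemma exists_translation (hc : ∀ v p q, SymmetricVertices c ⟨v, p⟩ ⟨v, q⟩)
    (x : Σ v, Fin (f v)) :
    ∃ τ : α → α, ∀ e : (blowUp G f).edgeSet, x ∈ (e : Sym2 _) →
      (blowUpColoring (c.pullback (blowUpSection G z)) f e).2 ⊆ {x} →
      c e = τ (blowUpColoring (c.pullback (blowUpSection G z)) f e).1 := by
  obtain ⟨τ, hτ⟩ := (hc x.1 (z x.1) x.2).exists_translation
  refine ⟨τ, ?_⟩
  rintro ⟨e, he⟩ hx hS
  obtain ⟨y, rfl⟩ := Sym2.mem_iff_exists.1 hx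
  have hxy : G.Adj x.1 y.1 := he
  refine (hτ y hxy hxy).trans (congrArg τ (get_eq_get_of_notMem_saturated hc hxy fun hs => ?_))
  rw [EdgeLabeling.get_comm] at hs
  have hyx : y = x := hS ⟨Sym2.mem_mk_right x y, hs⟩
  exact hxy.ne (congrArg Sigma.fst hyx.symm)

lemma eq_fst_of_snd_eq_empty (hc : ∀ v p q, SymmetricVertices c ⟨v, p⟩ ⟨v, q⟩)
    {e : (blowUp G f).edgeSet}
    (hS : (blowUpColoring (c.pullback (blowUpSection G z)) f e).2 = ∅) :
    c e = (blowUpColoring (c.pullback (blowUpSection G z)) f e).1 := by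
  obtain ⟨⟨x, y⟩, he⟩ := e
  have hxy : G.Adj x.1 y.1 := he
  have hx : (c.pullback (blowUpSection G z)).get x.1 y.1 hxy ∉
      saturated (c.pullback (blowUpSection G z)) x.1 := fun hs =>
    Set.notMem_empty x (hS.subset ⟨Sym2.mem_mk_left x y, hs⟩)
  have hy : (c.pullback (blowUpSection G z)).get y.1 x.1 hxy.symm ∉
      saturated (c.pullback (blowUpSection G z)) y.1 := fun hs => by
    rw [EdgeLabeling.get_comm] at hs
    exact Set.notMem_empty y (hS.subset ⟨Sym2.mem_mk_right x y, hs⟩)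
  have hxz := get_eq_get_of_notMem_saturated hc hxy hy
  obtain ⟨-, -, _, hσ⟩ := hc x.1 (z x.1) x.2
  exact ((hσ y hxy hxy).1 (hxz ▸ mt get_mem_saturated_pullback_blowUpSection hx)).trans hxz

lemma eq_of_blowUpColoring_eq (hc : ∀ v p q, SymmetricVertices c ⟨v, p⟩ ⟨v, q⟩)
    {e e' : (blowUp G f).edgeSet}
    (h : blowUpColoring (c.pullback (blowUpSection G z)) f e =
      blowUpColoring (c.pullback (blowUpSection G z)) f e') : c e = c e' := by
  by_cases hS : (blowUpColoring (c.pullback (blowUpSection G z)) f e).2.Subsingleton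
  · rcases hS.eq_empty_or_singleton with hS | ⟨x, hS⟩
    · rw [eq_fst_of_snd_eq_empty hc hS, eq_fst_of_snd_eq_empty hc (h ▸ hS), h]
    · obtain ⟨τ, hτ⟩ := exists_translation hc x
      have hS' := h ▸ hS
      rw [hτ e (hS.symm.subset rfl).1 hS.subset, hτ e' (hS'.symm.subset rfl).1 hS'.subset, h]
  · obtain ⟨x, hx, y, hy, hxy⟩ := Set.not_subsingleton_iff.1 hS
    have he := (Sym2.mem_and_mem_iff hxy).1 ⟨hx.1, hy.1⟩
    have he' := (Sym2.mem_and_mem_iff hxy).1 ⟨(h ▸ hx).1, (h ▸ hy).1⟩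
    exact congrArg c (Subtype.ext (he.trans he'.symm))

end BlowUp

section ColorClasses

variable {E α β : Type*} [Finite E] {b : E → β} {c : E → α}

lemma ncard_range_le_of_refines (h : ∀ e e', b e = b e' → c e = c e') :
    (Set.range c).ncard ≤ (Set.range b).ncard := by
  rcases isEmpty_or_nonempty E with hE | ⟨⟨e⟩⟩
  · rw [Set.range_eq_empty c, Set.ncard_empty]
    exact Nat.zero_le _
  have : Nonempty α := ⟨c e⟩
  obtain ⟨g, rfl⟩ := (Function.factorsThrough_iff (f := b) c).1 fun e e' => h e e'
  rw [Set.range_comp]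
  exact Set.ncard_image_le (Set.finite_range b)

lemma eq_of_eq_of_ncard_range_le (h : ∀ e e', b e = b e' → c e = c e')
    (hle : (Set.range b).ncard ≤ (Set.range c).ncard) {e e' : E} (hc : c e = c e') :
    b e = b e' := by
  have : Nonempty α := ⟨c e⟩
  obtain ⟨g, rfl⟩ := (Function.factorsThrough_iff (f := b) c).1 fun e e' => h e e'
  rw [Set.range_comp] at hle
  have injOn_g := Set.injOn_of_ncard_image_eq
    (le_antisymm (Set.ncard_image_le (Set.finite_range b)) hle) (Set.finite_range b)
  exact injOn_g (Set.mem_range_self e) (Set.mem_range_self e') hc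

end ColorClasses

lemma isColoredIso_of_forall_iff {V W α β : Type*} {G : SimpleGraph V} {G' : SimpleGraph W}
    {c : EdgeLabeling G α} {c' : EdgeLabeling G' β} {ρ : G ≃g G'}
    (h : ∀ e e', c e = c e' ↔ c' (ρ.mapEdgeSet e) = c' (ρ.mapEdgeSet e')) :
    IsColoredIso c c' ρ := by
  choose g hg using fun a : Set.range c => a.2
  have map_g (e) : c' (ρ.mapEdgeSet (g ⟨c e, Set.mem_range_self e⟩)) = c' (ρ.mapEdgeSet e) :=
    (h _ _).1 (hg _)
  refine ⟨Equiv.ofBijective (fun a => ⟨c' (ρ.mapEdgeSet (g a)), Set.mem_range_self _⟩)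
    ⟨fun a a' haa' => ?_, ?_⟩, map_g⟩
  · have hcc := (h _ _).2 (congrArg Subtype.val haa')
    rw [hg, hg] at hcc
    exact Subtype.ext hcc
  · rintro ⟨_, e', rfl⟩
    obtain ⟨e, rfl⟩ := ρ.mapEdgeSet.surjective e'
    exact ⟨⟨c e, Set.mem_range_self e⟩, Subtype.ext (map_g e)⟩

section UniqueColors

variable {V α : Type*} {G : SimpleGraph V}

/-- The colours that appear on exactly one edge. -/
def uniqueColors (C : EdgeLabeling G α) : Set α :=
  {a | ∃! e, C e = a}

/-- The colours that appear on at least two edges. -/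
def repeatedColors (C : EdgeLabeling G α) : Set α :=
  Set.range C \ uniqueColors C

/-- The subgraph of the edges whose colour appears on no other edge. -/
def uniqueGraph (C : EdgeLabeling G α) : SimpleGraph V where
  Adj x y := ∃ h : G.Adj x y, C.get x y h ∈ uniqueColors C
  symm := ⟨fun x y ⟨h, hC⟩ => ⟨h.symm, by rwa [EdgeLabeling.get_comm]⟩⟩
  loopless := ⟨fun _ ⟨h, _⟩ => G.irrefl h⟩

variable {C : EdgeLabeling G α}

lemma uniqueGraph_le : uniqueGraph C ≤ G :=
  fun _ _ h => h.1

lemma mem_edgeSet_uniqueGraph {e : G.edgeSet} :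
    (e : Sym2 V) ∈ (uniqueGraph C).edgeSet ↔ C e ∈ uniqueColors C := by
  obtain ⟨⟨x, y⟩, he⟩ := e
  exact ⟨fun h => h.2, fun h => ⟨he, h⟩⟩

lemma eq_of_mem_uniqueColors {e e' : G.edgeSet} (h : C e ∈ uniqueColors C) (he : C e = C e') :
    e = e' :=
  h.unique rfl he.symm

lemma card_edgeFinset_uniqueGraph [Fintype (uniqueGraph C).edgeSet] :
    #(uniqueGraph C).edgeFinset = (uniqueColors C).ncard := by
  have image_val : Subtype.val '' (C ⁻¹' uniqueColors C) = (uniqueGraph C).edgeSet := by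
    ext e
    refine ⟨?_, fun he => ?_⟩
    · rintro ⟨e, he, rfl⟩
      exact mem_edgeSet_uniqueGraph.2 he
    · exact ⟨⟨e, edgeSet_mono uniqueGraph_le he⟩, mem_edgeSet_uniqueGraph.1 he, rfl⟩
  have image_color : C '' (C ⁻¹' uniqueColors C) = uniqueColors C :=
    Set.image_preimage_eq_of_subset fun a ha => ha.exists
  have injOn : Set.InjOn C (C ⁻¹' uniqueColors C) :=
    fun _ he _ _ h => eq_of_mem_uniqueColors he h
  calc #(uniqueGraph C).edgeFinset = (uniqueGraph C).edgeSet.ncard :=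
        (Set.ncard_eq_toFinset_card' _).symm
    _ = (C ⁻¹' uniqueColors C).ncard := by
        rw [← image_val, Set.ncard_image_of_injective _ Subtype.val_injective]
    _ = (C '' (C ⁻¹' uniqueColors C)).ncard :=
        injOn.ncard_image.symm
    _ = (uniqueColors C).ncard := congrArg Set.ncard image_color

lemma numColors_eq_add [Finite V] [Fintype (uniqueGraph C).edgeSet] :
    numColors C = #(uniqueGraph C).edgeFinset + (repeatedColors C).ncard := by
  rw [card_edgeFinset_uniqueGraph, add_comm]
  exact (Set.ncard_sdiff_add_ncard_of_subset (fun a ha => ha.exists) (Set.finite_range C)).symm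

lemma isRainbowPlusOne_uniqueGraph {C : TopEdgeLabeling V α} {a : α}
    (ha : repeatedColors C = {a}) : IsRainbowPlusOne C (uniqueGraph C) := by
  refine ⟨fun e₁ e₂ h₁ _ h => eq_of_mem_uniqueColors (mem_edgeSet_uniqueGraph.1 h₁) h, a,
    fun e => ?_⟩
  rw [mem_edgeSet_uniqueGraph, ← Set.mem_singleton_iff, ← ha]
  exact ⟨fun h => ⟨Set.mem_range_self e, h⟩, fun h => h.2⟩

lemma RainbowFree.robustlyCliqueFree_uniqueGraph {C : TopEdgeLabeling V α} {k : ℕ}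
    (hC : RainbowFree (completeGraph (Fin k)) C) : RobustlyCliqueFree (uniqueGraph C) k := by
  intro u v X hX
  refine rainbowFree_completeGraph_iff.1 hC X ⟨fun x _ y _ hxy => hxy, hX.card_eq⟩ ?_
  have unique_or_eq : ∀ e : (⊤ : SimpleGraph V).edgeSet, (∀ x ∈ (e : Sym2 V), x ∈ X) →
      C e ∈ uniqueColors C ∨ s(u, v) = (e : Sym2 V) := by
    rintro ⟨⟨x, y⟩, hxy⟩ he
    rcases hX.isClique (he x (Sym2.mem_mk_left x y)) (he y (Sym2.mem_mk_right x y)) hxy with h | h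
    · exact Or.inl h.2
    · exact Or.inr ((adj_edge u v).1 h).1
  intro e he e' he' h
  rcases unique_or_eq e he with hu | hu
  · exact eq_of_mem_uniqueColors hu h
  rcases unique_or_eq e' he' with hu' | hu'
  · exact (eq_of_mem_uniqueColors hu' h.symm).symm
  · exact Subtype.ext (hu.symm.trans hu')

end UniqueColors

section BlowUpColors

variable {V α : Type*} {G : SimpleGraph V} {C : EdgeLabeling G α}

lemma snd_blowUpColoring_subsingleton {f : V → ℕ} {e : (blowUp G f).edgeSet}
    (he : (blowUpColoring C f e).1 ∉ uniqueColors C) :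
    (blowUpColoring C f e).2.Subsingleton := by
  rintro x ⟨hxe, hx⟩ y ⟨hye, hy⟩
  by_contra hxy
  have hadj : (blowUp G f).Adj x y := by
    rw [← mem_edgeSet, ← (Sym2.mem_and_mem_iff hxy).1 ⟨hxe, hye⟩]
    exact e.2
  have hne : x.1 ≠ y.1 := G.ne_of_adj hadj
  exact he ⟨_, rfl, fun e' he' => eq_of_mem_saturated hne hx hy he'⟩

variable {t : ℕ}

lemma ncard_blowUpColoring_unique_le [Fintype V] [DecidableRel (uniqueGraph C).Adj] (t : ℕ) :
    {β ∈ Set.range (blowUpColoring C fun _ => t) | β.1 ∈ uniqueColors C}.ncard ≤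
      t ^ 2 * #(uniqueGraph C).edgeFinset := by
  classical
  let ι : blowUp (uniqueGraph C) (fun _ => t) →g blowUp G fun _ => t :=
    ⟨id, fun {x y} h => (Exists.fst h : G.Adj x.1 y.1)⟩
  rw [← card_edgeFinset_blowUp]
  refine (Set.ncard_le_ncard ?_ (Set.finite_range _)).trans
    (numColors_le_card_edgeFinset (C := (blowUpColoring C fun _ => t).pullback ι))
  rintro _ ⟨⟨⟨⟨x, y⟩, he⟩, rfl⟩, hβ⟩
  exact ⟨⟨s(x, y), he, hβ⟩, rfl⟩

lemma ncard_blowUpColoring_fiber_le (ht : 0 < t) {a : α} (ha : a ∉ uniqueColors C) :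
    {β ∈ Set.range (blowUpColoring C fun _ => t) | β.1 = a}.ncard ≤ t := by
  by_cases hv : ∃ v, a ∈ saturated C v
  · obtain ⟨v, hv⟩ := hv
    calc _ ≤ (Set.range fun q : Fin t => (a, {(⟨v, q⟩ : Σ _ : V, Fin t)})).ncard := by
          refine Set.ncard_le_ncard ?_ (Set.finite_range _)
          rintro _ ⟨⟨e, rfl⟩, rfl⟩
          obtain ⟨⟨v, q⟩, hx, rfl⟩ := Sym2.mem_map.1 (mem_of_mem_saturated hv)
          exact ⟨q, Prod.ext rfl
            ((snd_blowUpColoring_subsingleton ha).eq_singleton_of_mem ⟨hx, hv⟩).symm⟩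
      _ ≤ t := (Finite.card_range_le _).trans_eq (Nat.card_fin t)
  · refine (Set.ncard_le_ncard (t := {(a, ∅)}) ?_).trans ((Set.ncard_singleton _).trans_le ht)
    rintro _ ⟨⟨e, rfl⟩, rfl⟩
    exact Prod.ext rfl (Set.eq_empty_of_forall_notMem fun x hx => hv ⟨x.1, hx.2⟩)

lemma ncard_blowUpColoring_repeated_le [Finite V] (ht : 0 < t) :
    {β ∈ Set.range (blowUpColoring C fun _ => t) | β.1 ∈ repeatedColors C}.ncard ≤
      t * (repeatedColors C).ncard := by
  classical
  have hR : (repeatedColors C).Finite := (Set.finite_range C).sdiff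
  have hB : {β ∈ Set.range (blowUpColoring C fun _ => t) | β.1 ∈ repeatedColors C}.Finite :=
    (Set.finite_range _).subset fun _ h => h.1
  rw [Set.ncard_eq_toFinset_card _ hB, Set.ncard_eq_toFinset_card _ hR]
  refine card_le_mul_card_image_of_maps_to (f := Prod.fst) (by simp) t fun a ha => ?_
  rw [← Set.ncard_coe_finset]
  refine (Set.ncard_le_ncard (fun β hβ => ?_) ((Set.finite_range _).subset fun _ h => h.1)).trans
    (ncard_blowUpColoring_fiber_le ht (hR.mem_toFinset.1 ha).2)
  obtain ⟨hβB, hβa⟩ := mem_filter.1 (mem_coe.1 hβ)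
  exact ⟨(hB.mem_toFinset.1 hβB).1, hβa⟩

lemma numColors_blowUpColoring_le [Fintype V] [DecidableRel (uniqueGraph C).Adj] (ht : 0 < t) :
    numColors (blowUpColoring C fun _ => t) ≤
      t ^ 2 * #(uniqueGraph C).edgeFinset + t * (repeatedColors C).ncard := by
  have range_subset : Set.range (blowUpColoring C fun _ => t) ⊆
      {β ∈ Set.range (blowUpColoring C fun _ => t) | β.1 ∈ uniqueColors C} ∪
        {β ∈ Set.range (blowUpColoring C fun _ => t) | β.1 ∈ repeatedColors C} := by
    rintro _ ⟨e, rfl⟩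
    by_cases he : (blowUpColoring C (fun _ => t) e).1 ∈ uniqueColors C
    · exact Or.inl ⟨⟨e, rfl⟩, he⟩
    · exact Or.inr ⟨⟨e, rfl⟩, ⟨_, rfl⟩, he⟩
  refine (Set.ncard_le_ncard range_subset (((Set.finite_range _).subset fun _ h => h.1).union
    ((Set.finite_range _).subset fun _ h => h.1))).trans ((Set.ncard_union_le _ _).trans ?_)
  exact add_le_add (ncard_blowUpColoring_unique_le t) (ncard_blowUpColoring_repeated_le ht)

end BlowUpColors

section SymmetricExtremal

lemma eq_and_eq_one_of_sq_mul_lt {t T u m : ℕ} (ht : 2 ≤ t) (hu : u ≤ T) (hum : u + m ≤ T + 1)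
    (h : t ^ 2 * T < t ^ 2 * u + t * m) : u = T ∧ m = 1 := by
  obtain ⟨d, rfl⟩ := Nat.exists_eq_add_of_le hu
  have hlt : t * d < m :=
    lt_of_mul_lt_mul_left (a := t) (by linarith [pow_two t, mul_assoc t t d]) (Nat.zero_le t)
  have hd : 2 * d ≤ t * d := Nat.mul_le_mul_right d ht
  omega

variable {r p t : ℕ} {c : EdgeLabeling (completeMultipartiteGraph fun _ : Fin r => Fin t) ℕ}

lemma IsExtremalColoring.card_uniqueGraph_and_ncard_repeatedColors (hp : 2 ≤ p) (hr : p + 2 ≤ r)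
    (ht : 2 ≤ t) (hc : IsExtremalColoring (completeGraph (Fin (p + 2))) c)
    {C : TopEdgeLabeling (Fin r) ℕ} [DecidableRel (uniqueGraph C).Adj]
    (hC : RainbowFree (completeGraph (Fin (p + 2))) C)
    (hle : numColors c ≤ numColors (blowUpColoring C fun _ => t)) :
    #(uniqueGraph C).edgeFinset = #(turanGraph r p).edgeFinset ∧
      (repeatedColors C).ncard = 1 := by
  have hlow := sq_mul_card_edgeFinset_turanGraph_lt_numColors (by omega) (by omega) (by omega) hc
  have hfree := hC.robustlyCliqueFree_uniqueGraph
  have hunique := hfree.card_edgeFinset_le hp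
    (hfree.ne_top (Nat.succ_pos _) (by rwa [Fintype.card_fin]))
  have hcolors := numColors_le_of_rainbowFree hp hC
  rw [Fintype.card_fin] at hunique hcolors
  rw [numColors_eq_add] at hcolors
  exact eq_and_eq_one_of_sq_mul_lt ht hunique hcolors
    ((hlow.trans_le hle).trans_le (numColors_blowUpColoring_le (by omega)))

end SymmetricExtremal

end AntiRamsey

theorem mainTheorem5 (r k t : ℕ) (hk : 4 ≤ k) (hr : k < r) (ht : 2 ≤ t)
    (c : SimpleGraph.EdgeLabeling
      (SimpleGraph.completeMultipartiteGraph (fun _ : Fin r => Fin t)) ℕ)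
    (hext : AntiRamsey.IsExtremalColoring (SimpleGraph.completeGraph (Fin k)) c)
    (hsym : AntiRamsey.TotallySymmetric c) :
    ∃ (cK : SimpleGraph.TopEdgeLabeling (Fin r) ℕ)
      (ρ : SimpleGraph.completeMultipartiteGraph (fun _ : Fin r => Fin t) ≃g
        AntiRamsey.blowUp (⊤ : SimpleGraph (Fin r)) (fun _ => t)),
      (∀ x, ρ x = x) ∧
      AntiRamsey.IsColoredIso c (AntiRamsey.blowUpColoring cK (fun _ => t)) ρ ∧
      ∃ L : SimpleGraph (Fin r), AntiRamsey.IsRainbowPlusOne cK L ∧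
        ((k = 4 ∧ r = 5 ∧
            (Nonempty (L ≃g AntiRamsey.hourglass) ∨ Nonempty (L ≃g AntiRamsey.house))) ∨
          (k = 4 ∧ r = 6 ∧ Nonempty (L ≃g AntiRamsey.prism)) ∨
          Nonempty (L ≃g SimpleGraph.turanGraph r (k - 2))) := by
  classical
  open AntiRamsey SimpleGraph Finset in
  obtain ⟨p, rfl⟩ : ∃ p, k = p + 2 := ⟨k - 2, by omega⟩
  have hp : 2 ≤ p := by omega
  let s := blowUpSection (⊤ : SimpleGraph (Fin r)) (f := fun _ => t) fun _ => ⟨0, by omega⟩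
  let cK : TopEdgeLabeling (Fin r) ℕ := EdgeLabeling.pullback c s
  let b := blowUpColoring cK fun _ => t
  have hcK : RainbowFree (completeGraph (Fin (p + 2))) cK :=
    RainbowFree.pullback hext.1 s fun _ _ h => congrArg Sigma.fst h
  have hbc (e e') : b e = b e' → c e = c e' := eq_of_blowUpColoring_eq hsym
  have hle : numColors b ≤ numColors c := hext.numColors_le (rainbowFree_blowUpColoring hcK _)
  have hcb (e e') : c e = c e' → b e = b e' := eq_of_eq_of_ncard_range_le hbc hle
  obtain ⟨hcard, hone⟩ := hext.card_uniqueGraph_and_ncard_repeatedColors hp hr.le ht hcK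
    (ncard_range_le_of_refines hbc)
  obtain ⟨a, ha⟩ := Set.ncard_eq_one.1 hone
  refine ⟨cK, RelIso.refl _, fun _ => rfl, isColoredIso_of_forall_iff ?_, uniqueGraph cK,
    isRainbowPlusOne_uniqueGraph ha, ?_⟩
  · rintro ⟨⟨x, y⟩, h⟩ ⟨⟨x', y'⟩, h'⟩
    exact ⟨hcb _ _, hbc _ _⟩
  · have hiso := hcK.robustlyCliqueFree_uniqueGraph.nonempty_iso_of_card_eq hp (by simpa)
      (by rwa [Fintype.card_fin])
    rw [Fintype.card_fin] at hiso
    simpa using hiso
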